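/- **Conventions.** Algebras are complex and need not be unital; a projection is a self-adjoint idempotent. For a nonempty subset $S$ of a $*$-algebra $A$ let $R(S)=\{x\in A: sx=0\ \forall s\in S\}$. $A$ is a *Baer $*$-algebra* if for each nonempty $S\subseteq A$ there is a projection $g$ with $R(S)=gA$ (such an $A$ is unital). A $*$-subalgebra $B$ of $A$ is a *Baer $*$-subalgebra* if for each nonempty $S\subseteq B$ there is a projection $p\in B$ with $R(S)=\{x\in A:px=0\}=(1-p)A$, i.e. the right support of $S$ in $A$ lies in $B$. An *$AW^*$-algebra* is a $C^*$-algebra that is a Baer $*$-algebra; an *$AW^*$-subalgebra* of it is a norm closed $*$-subalgebra that is a Baer $*$-subalgebra. A topological $*$-algebra $A$ is a *locally $C^*$-algebra* if it is topologically $*$-isomorphic to the projective limit (the set of coherent families in the product, with the product topology) of a projective family of $C^*$-algebras $A_\alpha$ and $*$-homomorphisms $g_\alpha^\beta:A_\beta\to A_\alpha$ ($\alpha\preceq\beta$) over a directed set $\Lambda$; it is a *locally $AW^*$-algebra* if moreover it is a Baer $*$-algebra. A *locally $AW^*$-subalgebra* is a $*$-subalgebra that is a locally $C^*$-algebra in the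 induced topology and a Baer $*$-subalgebra. An *Arens–Michael decomposition* of $A$ is a realization $A\cong\varprojlim A_\alpha$ of this kind in which all the natural projections $\pi_\alpha:A\to A_\alpha$ are surjective. For $*$-subalgebras $B\subseteq A$, $C_\alpha\subseteq A_\alpha$, we write $B\cong\varprojlim C_\alpha$ if $g_\alpha^\beta(C_\beta)\subseteq C_\alpha$ for $\alpha\preceq\beta$, $\pi_\alpha(B)\subseteq C_\alpha$ for all $\alpha$, and the restricted maps $\pi_\alpha|_B$, $g_\alpha^\beta|_{C_\beta}$ realize $B$ (with the induced topology) as the projective limit of the $C_\alpha$. **Theorem 2.** Let $A$ be a locally $AW^*$-algebra. Then 1. the center $Z$ of $A$, each maximal commutative $*$-subalgebra $B$ of $A$, and each corner $eAe$ ($e$ a projection in $A$) are locally $AW^*$-subalgebras of $A$. 2. Let $A\cong\varprojlim A_\alpha$ be any Arens–Michael decomposition of $A$. (a) $\pi_\alpha(Z)$ is the center $Z_\alpha$ of $A_\alpha$ for each $\alpha$, $Z_\alpha$ is an $AW^*$-subalgebra of $A_\alpha$ whenever $A_\alpha$ is an $AW^*$-algebra, and $Z\cong\varprojlim Z_\alpha$.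 (b) Let $B$ be a maximal commutative $*$-subalgebra of $A$ and $B_\alpha=\pi_\alpha(B)$. Each $B_\alpha$ is norm closed in $A_\alpha$, and $B\cong\varprojlim B_\alpha$. The commutant $B_\alpha'$ of $B_\alpha$ in $A_\alpha$ is an $AW^*$-subalgebra of $A_\alpha$ whenever $A_\alpha$ is an $AW^*$-algebra, and $B\cong\varprojlim B_\alpha'$. Moreover, if for each $\alpha$ any maximal commutative $*$-subalgebra $C_\alpha\supseteq B_\alpha$ of $A_\alpha$ is chosen, then $C_\alpha$ is an $AW^*$-subalgebra of $A_\alpha$ whenever $A_\alpha$ is an $AW^*$-algebra, and $B=\{x\in A:\pi_\alpha(x)\in C_\alpha\ \forall\alpha\}$. (c) For each projection $e\in A$, with $e_\alpha=\pi_\alpha(e)$: $\pi_\alpha(eAe)=e_\alpha A_\alpha e_\alpha$ for each $\alpha$, this is an $AW^*$-subalgebra of $A_\alpha$ whenever $A_\alpha$ is an $AW^*$-algebra, and $eAe\cong\varprojlim e_\alpha A_\alpha e_\alpha$. -/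

import Mathlib

universe u v w

/-- The right annihilator `R(S) = {x : s x = 0 for all s ∈ S}` of a subset `S`. -/
def rightAnnihilator {A : Type*} [NonUnitalRing A] (S : Set A) : Set A :=
  {x | ∀ s ∈ S, s * x = 0}

/-- A Baer `*`-algebra: the right annihilator of each nonempty subset is of the form `g A`
with `g` a projection (a self-adjoint idempotent). -/
def IsBaerStar (A : Type*) [NonUnitalRing A] [StarRing A] : Prop :=
  ∀ S : Set A, S.Nonempty →
    ∃ g : A, IsStarProjection g ∧ rightAnnihilator S = {x | ∃ a, x = g * a}

section Subalgebras

variable {A : Type*} [NonUnitalRing A] [StarRing A] [Module ℂ A] [IsScalarTower ℂ A A]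
  [SMulCommClass ℂ A A] [StarModule ℂ A]

/-- A Baer `*`-subalgebra `B` of a Baer `*`-algebra `A`: for each nonempty `S ⊆ B` the right
annihilator of `S` in `A` is `(1 - p) A` with a projection `p` in `B`, that is, the right support
of `S` computed in `A` belongs to `B`. The set `(1 - p) A` is written as `{x | p x = 0}`, so that
the unit of `A` need not be named; `B` need not contain the unit of `A`. -/
def IsBaerStarSubalgebra (B : NonUnitalStarSubalgebra ℂ A) : Prop :=
  ∀ S : Set A, S ⊆ B → S.Nonempty →
    ∃ p ∈ B, IsStarProjection p ∧ rightAnnihilator S = {x | p * x = 0}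

/-- `B` is maximal among the commutative `*`-subalgebras of `A`. -/
def IsMaximalCommutative (B : NonUnitalStarSubalgebra ℂ A) : Prop :=
  Maximal (fun C : NonUnitalStarSubalgebra ℂ A => ∀ x ∈ C, ∀ y ∈ C, x * y = y * x) B

/-- The corner `e A e` of a projection `e`. -/
def starCorner (e : A) (he : IsStarProjection e) : NonUnitalStarSubalgebra ℂ A where
  carrier := {x | ∃ a, x = e * a * e}
  add_mem' := by
    rintro _ _ ⟨a, rfl⟩ ⟨b, rfl⟩
    exact ⟨a + b, by rw [mul_add, add_mul]⟩
  zero_mem' := ⟨0, by simp⟩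
  mul_mem' := by
    rintro _ _ ⟨a, rfl⟩ ⟨b, rfl⟩
    exact ⟨a * e * (e * b), by simp only [mul_assoc]⟩
  smul_mem' := by
    rintro c _ ⟨a, rfl⟩
    exact ⟨c • a, by rw [mul_smul_comm, smul_mul_assoc]⟩
  star_mem' := by
    rintro _ ⟨a, rfl⟩
    exact ⟨star a, by simp only [star_mul, he.isSelfAdjoint.star_eq, mul_assoc]⟩

end Subalgebras

/-- A realization of the topological `*`-algebra `A` as the projective limit of a projective family
`F α`, `α ∈ Λ`, of topological `*`-algebras: connecting `*`-homomorphisms `g α β : F β → F α` for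
`α ≤ β`, and projections `π α : A → F α` such that `x ↦ (π α x)` is a homeomorphism of `A` onto the
set of all coherent families in the product `∏ F α`. -/
structure ProjectiveLimit (A : Type*) [NonUnitalRing A] [StarRing A] [Module ℂ A]
    [TopologicalSpace A] {Λ : Type*} [PartialOrder Λ] (F : Λ → Type*)
    [∀ α, NonUnitalRing (F α)] [∀ α, StarRing (F α)] [∀ α, Module ℂ (F α)]
    [∀ α, TopologicalSpace (F α)] where
  g : ∀ α β : Λ, α ≤ β → F β →⋆ₙₐ[ℂ] F α
  g_continuous : ∀ α β (h : α ≤ β), Continuous (g α β h)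
  g_refl : ∀ α (x : F α), g α α le_rfl x = x
  g_comp : ∀ α β γ (h : α ≤ β) (k : β ≤ γ) (x : F γ), g α β h (g β γ k x) = g α γ (h.trans k) x
  π : ∀ α : Λ, A →⋆ₙₐ[ℂ] F α
  g_π : ∀ α β (h : α ≤ β) (a : A), g α β h (π β a) = π α a
  isEmbedding : Topology.IsEmbedding (fun (a : A) (α : Λ) => π α a)
  exists_lift : ∀ x : (α : Λ) → F α, (∀ α β (h : α ≤ β), g α β h (x β) = x α) →
    ∃ a : A, ∀ α, π α a = x α

/-- A locally `C*`-algebra: a topological `*`-algebra that is topologically `*`-isomorphic to the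
projective limit of a projective family of `C*`-algebras over a directed set. -/
def IsLocallyCStar (A : Type u) [NonUnitalRing A] [StarRing A] [Module ℂ A]
    [TopologicalSpace A] : Prop :=
  ∃ (Λ : Type u) (_ : PartialOrder Λ) (_ : IsDirectedOrder Λ) (F : Λ → Type u)
    (_ : ∀ α, NonUnitalCStarAlgebra (F α)), Nonempty (ProjectiveLimit A F)

/-- A locally `AW*`-algebra: a locally `C*`-algebra that is a Baer `*`-algebra. -/
def IsLocallyAWStar (A : Type u) [NonUnitalRing A] [StarRing A] [Module ℂ A]
    [TopologicalSpace A] : Prop :=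
  IsLocallyCStar A ∧ IsBaerStar A

/-- A locally `AW*`-subalgebra: a `*`-subalgebra that is a locally `C*`-algebra in the induced
topology and a Baer `*`-subalgebra. -/
def IsLocallyAWStarSubalgebra {A : Type u} [NonUnitalRing A] [StarRing A] [Module ℂ A]
    [IsScalarTower ℂ A A] [SMulCommClass ℂ A A] [StarModule ℂ A] [TopologicalSpace A]
    (B : NonUnitalStarSubalgebra ℂ A) : Prop :=
  IsLocallyCStar B ∧ IsBaerStarSubalgebra B

/-- An `AW*`-algebra: a `C*`-algebra that is a Baer `*`-algebra. -/
def IsAWStar (A : Type*) [NonUnitalCStarAlgebra A] : Prop :=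
  IsBaerStar A

/-- An `AW*`-subalgebra of an `AW*`-algebra: a `C*`-subalgebra (a norm closed `*`-subalgebra) that
is a Baer `*`-subalgebra. -/
def IsAWStarSubalgebra {A : Type*} [NonUnitalCStarAlgebra A]
    (B : NonUnitalStarSubalgebra ℂ A) : Prop :=
  IsClosed (B : Set A) ∧ IsBaerStarSubalgebra B

/-- The `*`-subalgebra `B` of `A = lim F α` is the projective limit of the `*`-subalgebras `C α` of
the factors `F α`, with the connecting maps and the projections of `A` restricted. -/
def ProjectiveLimit.RestrictsTo {A : Type*} [NonUnitalRing A] [StarRing A] [Module ℂ A]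
    [TopologicalSpace A] {Λ : Type*} [PartialOrder Λ] {F : Λ → Type*}
    [∀ α, NonUnitalCStarAlgebra (F α)] (D : ProjectiveLimit A F)
    (B : NonUnitalStarSubalgebra ℂ A) (C : ∀ α, NonUnitalStarSubalgebra ℂ (F α)) : Prop :=
  ∃ E : ProjectiveLimit B (fun α => C α),
    (∀ α β (h : α ≤ β) (x : C β), (E.g α β h x : F α) = D.g α β h x) ∧
    ∀ α (b : B), (E.π α b : F α) = D.π α b

/-!
The heart of the matter is that each projection `π α` maps the center of `A` onto the center of
`F α`. Given `0 ≤ z` central in `F α` with `‖z‖ ≤ 3 s`, lift `z` to a self-adjoint `x` and compare,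
in the Baer `*`-algebra `A`, the supports of continuous cutoffs of `x` near the levels `2 s` and
`s`. Up to a partial isometry that `π α` kills, the comparison yields a central projection `c` of
`A` separating the two levels, so that `0 ≤ z - s • π α c` and `‖z - s • π α c‖ ≤ 2 s`. Iterating
with ratio `2 / 3` exhibits `z` as a limit of images of central elements.

These images are closed: by functional calculus an element of a commutant in `A` can be truncated to
have norm at most `2 ‖π α b‖` in every factor without changing its component `π α b`, hence a series
that converges fast in `F α` lifts to one that converges in all factors simultaneously.

Comparison of orthogonal projections needs sums of orthogonal partial isometries `v`; instead of
a limit, which the topology does not provide, the sum is a corner of the supremum of the projections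
onto the graphs of the `v`.
-/

section Projections

variable {A : Type*} [NonUnitalRing A] [StarRing A] {e f p v : A}

theorem mul_star_eq_star_iff (hp : IsSelfAdjoint p) : p * star v = star v ↔ v * p = v := by
  rw [← star_inj, star_mul, star_star, hp.star_eq]

theorem commute_of_mul_mul_self_eq {t : A} (hp : IsSelfAdjoint p) (h : p * t * p = p * t)
    (h' : p * star t * p = p * star t) : Commute p t := by
  have h'' := congrArg star h'
  simp only [star_mul, star_star, hp.star_eq, ← mul_assoc] at h''
  exact h.symm.trans h''

/-- The projection `p` is the right support of `S`: the least projection with `s p = s` for all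
`s ∈ S`. Minimality is expressed by `S x = 0 → p x = 0`, which does not refer to a unit. -/
structure IsRightSupport (S : Set A) (p : A) : Prop where
  isStarProjection : IsStarProjection p
  mul_eq : ∀ s ∈ S, s * p = s
  mul_eq_zero : ∀ x, (∀ s ∈ S, s * x = 0) → p * x = 0

namespace IsRightSupport

variable {S : Set A}

theorem isSelfAdjoint (h : IsRightSupport S p) : IsSelfAdjoint p :=
  h.isStarProjection.isSelfAdjoint

theorem mul_congr (h : IsRightSupport S p) {x y : A} (hxy : ∀ s ∈ S, s * x = s * y) :
    p * x = p * y := by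
  rw [← sub_eq_zero, ← mul_sub]
  exact h.mul_eq_zero _ fun s hs => by rw [mul_sub, hxy s hs, sub_self]

theorem mul_right_eq (h : IsRightSupport S p) {x : A} (hx : ∀ s ∈ S, s * x = s) : p * x = p :=
  (h.mul_congr fun s hs => (hx s hs).trans (h.mul_eq s hs).symm).trans
    h.isStarProjection.isIdempotentElem

theorem rightAnnihilator_eq (h : IsRightSupport S p) : rightAnnihilator S = {x | p * x = 0} := by
  ext x
  refine ⟨h.mul_eq_zero x, fun (hx : p * x = 0) s hs => ?_⟩
  rw [← h.mul_eq s hs, mul_assoc, hx, mul_zero]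

theorem mul_mul_self_eq (h : IsRightSupport S p) {t : A} (ht : ∀ s ∈ S, s * t * p = s * t) :
    p * t * p = p * t := by
  rw [mul_assoc]
  exact h.mul_congr fun s hs => by rw [← mul_assoc, ht s hs]

theorem commute (h : IsRightSupport S p) {t : A} (ht : ∀ s ∈ S, Commute s t)
    (ht' : ∀ s ∈ S, Commute s (star t)) : Commute p t :=
  commute_of_mul_mul_self_eq h.isSelfAdjoint
    (h.mul_mul_self_eq fun s hs => by rw [(ht s hs).eq, mul_assoc, h.mul_eq s hs])
    (h.mul_mul_self_eq fun s hs => by rw [(ht' s hs).eq, mul_assoc, h.mul_eq s hs])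

theorem commute_of_mul_mem (h : IsRightSupport S p) (hS : ∀ s ∈ S, ∀ a, s * a ∈ S) (a : A) :
    Commute p a :=
  commute_of_mul_mul_self_eq h.isSelfAdjoint
    (h.mul_mul_self_eq fun s hs => h.mul_eq _ (hS s hs a))
    (h.mul_mul_self_eq fun s hs => h.mul_eq _ (hS s hs (star a)))

end IsRightSupport

namespace IsBaerStar

theorem exists_unit (hA : IsBaerStar A) :
    ∃ u : A, IsStarProjection u ∧ ∀ a, u * a = a ∧ a * u = a := by
  obtain ⟨u, hu, h⟩ := hA {0} (Set.singleton_nonempty 0)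
  have left_unit (a : A) : u * a = a := by
    have ha : a ∈ rightAnnihilator ({0} : Set A) := by simp [rightAnnihilator]
    obtain ⟨b, rfl⟩ := h ▸ ha
    exact hu.isIdempotentElem.mul_self_mul b
  exact ⟨u, hu, fun a => ⟨left_unit a, (mul_star_eq_star_iff hu.isSelfAdjoint).1 (left_unit _)⟩⟩

theorem exists_isRightSupport (hA : IsBaerStar A) (S : Set A) : ∃ p, IsRightSupport S p := by
  obtain ⟨u, hu, unit_mul⟩ := hA.exists_unit
  obtain ⟨g, hg, h⟩ := hA (insert 0 S) (Set.insert_nonempty 0 S)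
  refine ⟨u - g, hg.sub_of_mul_eq_right hu (unit_mul g).1, fun s hs => ?_, fun x hx => ?_⟩
  · have hgS : g ∈ rightAnnihilator (insert 0 S) := h ▸ ⟨g, hg.isIdempotentElem.eq.symm⟩
    rw [mul_sub, (unit_mul s).2, hgS s (Set.mem_insert_of_mem _ hs), sub_zero]
  · have hxS : x ∈ rightAnnihilator (insert 0 S) := by
      rintro s (rfl | hs)
      exacts [zero_mul x, hx s hs]
    obtain ⟨a, rfl⟩ := h ▸ hxS
    rw [sub_mul, (unit_mul _).1, hg.isIdempotentElem.mul_self_mul, sub_self]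

theorem exists_central_separation (hA : IsBaerStar A) {p q : A} (hp : IsIdempotentElem p)
    (hpq : ∀ a, p * a * q = 0) :
    ∃ c : A, IsStarProjection c ∧ (∀ a, Commute c a) ∧ p * c = p ∧ c * q = 0 := by
  obtain ⟨c, hc⟩ := hA.exists_isRightSupport (Set.range fun a => p * a)
  refine ⟨c, hc.isStarProjection, hc.commute_of_mul_mem ?_, ?_, hc.mul_eq_zero q ?_⟩
  · rintro _ ⟨a, rfl⟩ b
    exact ⟨a * b, (mul_assoc p a b).symm⟩
  · exact hc.mul_eq p ⟨p, hp⟩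
  · rintro _ ⟨a, rfl⟩
    exact hpq a

end IsBaerStar

end Projections

section Comparison

variable {A : Type*} [NonUnitalRing A] [StarRing A] {e f v : A}

/-- A partial isometry `v` whose initial projection `v* v` lies under `e` and whose final
projection `v v*` lies under `f`. -/
structure IsPartialIsometryBetween (e f v : A) : Prop where
  mul_left_eq : f * v = v
  mul_right_eq : v * e = v
  mul_star_mul_eq : v * star v * v = v

/-- Every nonzero corner `f A e` contains a nonzero partial isometry. -/
def HasPartialIsometries (A : Type*) [NonUnitalRing A] [StarRing A] : Prop :=
  ∀ e f : A, IsStarProjection e → IsStarProjection f → (∃ a, f * a * e ≠ 0) →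
    ∃ v, v ≠ 0 ∧ IsPartialIsometryBetween e f v

namespace IsPartialIsometryBetween

theorem mul_star_mul_eq' (hv : IsPartialIsometryBetween e f v) : v * (star v * v) = v := by
  rw [← mul_assoc, hv.mul_star_mul_eq]

theorem adjoint (he : IsSelfAdjoint e) (hf : IsSelfAdjoint f)
    (hv : IsPartialIsometryBetween e f v) : IsPartialIsometryBetween f e (star v) where
  mul_left_eq := (mul_star_eq_star_iff he).2 hv.mul_right_eq
  mul_right_eq := (mul_star_eq_star_iff hf).1 (by rw [star_star, hv.mul_left_eq])
  mul_star_mul_eq := by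
    rw [star_star, mul_assoc, ← star_star v, ← star_mul, ← star_mul, star_star, hv.mul_star_mul_eq]

theorem isStarProjection_star_mul_self (hv : IsPartialIsometryBetween e f v) :
    IsStarProjection (star v * v) :=
  ⟨by rw [IsIdempotentElem, mul_assoc, hv.mul_star_mul_eq'], IsSelfAdjoint.star_mul_self v⟩

theorem isStarProjection_mul_star_self (hv : IsPartialIsometryBetween e f v) :
    IsStarProjection (v * star v) :=
  ⟨by rw [IsIdempotentElem, ← mul_assoc, hv.mul_star_mul_eq], IsSelfAdjoint.mul_star_self v⟩

theorem isStarProjection_sub_star_mul_self (he : IsStarProjection e)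
    (hv : IsPartialIsometryBetween e f v) : IsStarProjection (e - star v * v) :=
  hv.isStarProjection_star_mul_self.sub_of_mul_eq_left he (by rw [mul_assoc, hv.mul_right_eq])

theorem isStarProjection_sub_mul_star_self (hf : IsStarProjection f)
    (hv : IsPartialIsometryBetween e f v) : IsStarProjection (f - v * star v) :=
  hv.isStarProjection_mul_star_self.sub_of_mul_eq_right hf (by rw [← mul_assoc, hv.mul_left_eq])

theorem mono {e₁ f₁ : A} (hv : IsPartialIsometryBetween e₁ f₁ v) (he : e₁ * e = e₁)
    (hf : f * f₁ = f₁) : IsPartialIsometryBetween e f v where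
  mul_left_eq := by rw [← hv.mul_left_eq, ← mul_assoc, hf]
  mul_right_eq := by rw [← hv.mul_right_eq, mul_assoc, he]
  mul_star_mul_eq := hv.mul_star_mul_eq

theorem mul_eq_zero (hv : IsPartialIsometryBetween e f v) {x : A} (hx : e * x = 0) :
    v * x = 0 := by
  rw [← hv.mul_right_eq, mul_assoc, hx, mul_zero]

theorem eq_zero_mul (hv : IsPartialIsometryBetween e f v) {x : A} (hx : x * f = 0) :
    x * v = 0 := by
  rw [← hv.mul_left_eq, ← mul_assoc, hx, zero_mul]

end IsPartialIsometryBetween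


/-- A family of partial isometries between `e` and `f` with pairwise orthogonal initial and
pairwise orthogonal final projections. -/
structure IsOrthogonalFamily (e f : A) (V : Set A) : Prop where
  isPartialIsometry : ∀ v ∈ V, IsPartialIsometryBetween e f v
  pairwise : V.Pairwise fun v w => v * star w = 0 ∧ star v * w = 0

namespace IsOrthogonalFamily

variable {V : Set A}

theorem exists_maximal (e f : A) : ∃ V, Maximal (IsOrthogonalFamily e f) V :=
  zorn_subset {V | IsOrthogonalFamily e f V} fun C hC hchain =>
    ⟨⋃₀ C, ⟨fun v ⟨_, hs, hv⟩ => (hC hs).isPartialIsometry v hv,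
      (Set.pairwise_sUnion hchain.directedOn).2 fun _ hs => (hC hs).pairwise⟩,
      fun _ hs => Set.subset_sUnion_of_mem hs⟩

theorem insert (hV : IsOrthogonalFamily e f V) (hv : IsPartialIsometryBetween e f v)
    (horth : ∀ u ∈ V, v * star u = 0 ∧ star v * u = 0) :
    IsOrthogonalFamily e f (insert v V) where
  isPartialIsometry := Set.forall_mem_insert.2 ⟨hv, hV.isPartialIsometry⟩
  pairwise := by
    refine Set.pairwise_insert.2 ⟨hV.pairwise, fun u hu _ => ⟨horth u hu, ?_⟩⟩
    simpa using And.intro (congrArg star (horth u hu).1) (congrArg star (horth u hu).2)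

-- The right support `p` of the elements `v* + v* v` is the supremum of the projections
-- `(v* v + v v* + v + v*) / 2` onto the graphs of the `v ∈ V`, so that its corner `2 f p e` is the
-- sum of the `v`; this is why no convergence is needed.
theorem exists_graph_support (hA : IsBaerStar A) (hef : e * f = 0)
    (hV : IsOrthogonalFamily e f V) :
    ∃ p : A, IsSelfAdjoint p ∧ ∀ v ∈ V,
      2 • (p * (star v * v)) = v + star v * v ∧ p * v = p * (star v * v) := by
  let r : A → A := fun v => star v + star v * v
  obtain ⟨p, hp⟩ := hA.exists_isRightSupport (r '' V)
  have mul_eq_zero {u v : A} (hu : u ∈ V) (hv : v ∈ V) : u * v = 0 :=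
    (hV.isPartialIsometry u hu).mul_eq_zero ((hV.isPartialIsometry v hv).eq_zero_mul hef)
  have r_mul {u v : A} (hu : u ∈ V) (hv : v ∈ V) : r u * v = star u * v := by
    rw [add_mul, mul_assoc, mul_eq_zero hu hv, mul_zero, add_zero]
  have r_mul_star_mul {u v : A} (hu : u ∈ V) (hv : v ∈ V) :
      r u * (star v * v) = star u * v := by
    have h : r u * star v = star u * u * star v := by
      rw [add_mul, ← star_mul, mul_eq_zero hv hu, star_zero, zero_add]
    rw [← mul_assoc, h]
    rcases eq_or_ne u v with rfl | huv
    · rw [mul_assoc, mul_assoc, (hV.isPartialIsometry u hu).mul_star_mul_eq']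
    · rw [(hV.pairwise hu hv huv).2, mul_assoc (star u), (hV.pairwise hu hv huv).1, mul_zero,
        zero_mul]
  have p_mul {v : A} (hv : v ∈ V) : p * v = p * (star v * v) := hp.mul_congr <| by
    rintro _ ⟨u, hu, rfl⟩
    rw [r_mul hu hv, r_mul_star_mul hu hv]
  refine ⟨p, hp.isSelfAdjoint, fun v hv => ⟨?_, p_mul hv⟩⟩
  calc 2 • (p * (star v * v)) = p * star (r v) := by
        rw [star_add, star_mul, star_star, mul_add, p_mul hv, two_nsmul]
    _ = star (r v) := (mul_star_eq_star_iff hp.isSelfAdjoint).2 (hp.mul_eq _ ⟨v, hv, rfl⟩)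
    _ = v + star v * v := by rw [star_add, star_mul, star_star]

theorem exists_mul_star_mul_eq (hA : IsBaerStar A) (he : IsStarProjection e)
    (hf : IsStarProjection f) (hef : e * f = 0) (hV : IsOrthogonalFamily e f V) :
    ∃ w : A, f * w = w ∧ ∀ v ∈ V, w * (star v * v) = v ∧ star w * v = star v * v := by
  obtain ⟨p, hp, hpV⟩ := hV.exists_graph_support hA hef
  have hfe : f * e = 0 := by
    simpa [he.isSelfAdjoint.star_eq, hf.isSelfAdjoint.star_eq] using congrArg star hef
  refine ⟨2 • (f * p * e), ?_, fun v hv => ?_⟩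
  · rw [mul_smul_comm, mul_assoc, hf.isIdempotentElem.mul_self_mul]
  have hv' := hV.isPartialIsometry v hv
  have hsv := hv'.adjoint he.isSelfAdjoint hf.isSelfAdjoint
  have sum_eq : 2 • (p * (star v * v)) = v + star v * v := (hpV v hv).1
  constructor
  · calc 2 • (f * p * e) * (star v * v) = f * (2 • (p * (e * star v * v))) := by
          simp only [smul_mul_assoc, mul_smul_comm, mul_assoc]
      _ = v := by
          rw [hsv.mul_left_eq, sum_eq, mul_add, hv'.mul_left_eq, ← mul_assoc,
            hsv.eq_zero_mul hfe, zero_mul, add_zero]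
  · calc star (2 • (f * p * e)) * v = e * (2 • (p * (f * v))) := by
          simp only [star_smul, star_mul, star_trivial, he.isSelfAdjoint.star_eq,
            hf.isSelfAdjoint.star_eq, hp.star_eq, smul_mul_assoc, mul_smul_comm, mul_assoc]
      _ = star v * v := by
          rw [hv'.mul_left_eq, (hpV v hv).2, sum_eq, mul_add, hv'.eq_zero_mul hef, zero_add,
            ← mul_assoc, hsv.mul_left_eq]

theorem exists_isPartialIsometryBetween (hA : IsBaerStar A) (he : IsStarProjection e)
    (hf : IsStarProjection f) (hef : e * f = 0) (hV : IsOrthogonalFamily e f V) :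
    ∃ w, IsPartialIsometryBetween e f w ∧
      ∀ v ∈ V, v * (star w * w) = v ∧ w * star w * v = v := by
  obtain ⟨w, hfw, hwV⟩ := hV.exists_mul_star_mul_eq hA he hf hef
  obtain ⟨p, hp⟩ := hA.exists_isRightSupport ((fun v => star v * v) '' V)
  have hpp : p * p = p := hp.isStarProjection.isIdempotentElem
  have hvp {v : A} (hv : v ∈ V) : star v * v * p = star v * v := hp.mul_eq _ ⟨v, hv, rfl⟩
  have hpv {v : A} (hv : v ∈ V) : p * (star v * v) = star v * v := by
    simpa using (mul_star_eq_star_iff hp.isSelfAdjoint).2 (hvp hv)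
  have p_mul_e : p * e = p := hp.mul_right_eq <| by
    rintro _ ⟨v, hv, rfl⟩
    simp only [mul_assoc, (hV.isPartialIsometry v hv).mul_right_eq]
  have p_mul_star_mul : p * (star w * w) = p := hp.mul_right_eq <| by
    rintro _ ⟨v, hv, rfl⟩
    have h₁ : star v * v * star w = star v := by simpa using congrArg star (hwV v hv).1
    have h₂ : star v * w = star v * v := by simpa using congrArg star (hwV v hv).2
    simp only [← mul_assoc, h₁, h₂]
  have star_mul_self : star (w * p) * (w * p) = p := by
    rw [star_mul, hp.isSelfAdjoint.star_eq, mul_assoc, ← mul_assoc (star w), ← mul_assoc p,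
      p_mul_star_mul, hpp]
  refine ⟨w * p, ⟨?_, ?_, ?_⟩, fun v hv => ⟨?_, ?_⟩⟩
  · rw [← mul_assoc, hfw]
  · rw [mul_assoc, p_mul_e]
  · rw [mul_assoc, star_mul_self, mul_assoc, hpp]
  · rw [star_mul_self, ← (hV.isPartialIsometry v hv).mul_star_mul_eq', mul_assoc, hvp hv]
  · rw [mul_assoc, star_mul, hp.isSelfAdjoint.star_eq, mul_assoc p, (hwV v hv).2, hpv hv,
      mul_assoc, hpv hv, (hwV v hv).1]

end IsOrthogonalFamily

theorem IsBaerStar.exists_isPartialIsometryBetween_maximal (hA : IsBaerStar A)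
    (hPI : HasPartialIsometries A) (he : IsStarProjection e) (hf : IsStarProjection f)
    (hef : e * f = 0) :
    ∃ w, IsPartialIsometryBetween e f w ∧
      ∀ a, (f - w * star w) * a * (e - star w * w) = 0 := by
  obtain ⟨V, hV⟩ := IsOrthogonalFamily.exists_maximal e f
  obtain ⟨w, hw, hwV⟩ := hV.prop.exists_isPartialIsometryBetween hA he hf hef
  refine ⟨w, hw, ?_⟩
  by_contra! hne
  have he' := hw.isStarProjection_sub_star_mul_self he
  have hf' := hw.isStarProjection_sub_mul_star_self hf
  obtain ⟨v, hv0, hv⟩ := hPI _ _ he' hf' hne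
  have hv_star := hv.adjoint he'.isSelfAdjoint hf'.isSelfAdjoint
  have mul_star_zero (u : A) (hu : u ∈ V) : v * star u = 0 := hv.mul_eq_zero <| by
    rw [← (mul_star_eq_star_iff hw.isStarProjection_star_mul_self.isSelfAdjoint).2 (hwV u hu).1,
      ← mul_assoc, sub_mul, hw.isStarProjection_star_mul_self.isIdempotentElem.eq,
      ← mul_assoc e, (hw.adjoint he.isSelfAdjoint hf.isSelfAdjoint).mul_left_eq, sub_self,
      zero_mul]
  have star_mul_zero (u : A) (hu : u ∈ V) : star v * u = 0 := hv_star.mul_eq_zero <| by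
    rw [← (hwV u hu).2, ← mul_assoc, sub_mul,
      hw.isStarProjection_mul_star_self.isIdempotentElem.eq, ← mul_assoc f, hw.mul_left_eq,
      sub_self, zero_mul]
  have hvV : v ∈ V := hV.mem_of_prop_insert <| hV.prop.insert
    (hv.mono (by rw [sub_mul, he.isIdempotentElem.eq, mul_assoc, hw.mul_right_eq])
      (by rw [mul_sub, hf.isIdempotentElem.eq, ← mul_assoc, hw.mul_left_eq]))
    fun u hu => ⟨mul_star_zero u hu, star_mul_zero u hu⟩
  exact hv0 (by rw [← hv.mul_star_mul_eq, mul_star_zero v hvV, zero_mul])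

theorem IsBaerStar.exists_comparison (hA : IsBaerStar A) (hPI : HasPartialIsometries A)
    (he : IsStarProjection e) (hf : IsStarProjection f) (hef : e * f = 0) :
    ∃ w c : A, IsPartialIsometryBetween e f w ∧ IsStarProjection c ∧ (∀ a, Commute c a) ∧
      (e - star w * w) * c = e - star w * w ∧ c * (f - w * star w) = 0 := by
  obtain ⟨w, hw, hzero⟩ := hA.exists_isPartialIsometryBetween_maximal hPI he hf hef
  have he' := hw.isStarProjection_sub_star_mul_self he
  have hf' := hw.isStarProjection_sub_mul_star_self hf
  obtain ⟨c, hc, hcomm, hec, hcf⟩ := hA.exists_central_separation he'.isIdempotentElem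
    (q := f - w * star w) fun a => by
      simpa only [star_mul, he'.isSelfAdjoint.star_eq, hf'.isSelfAdjoint.star_eq, star_star,
        star_zero, mul_assoc] using congrArg star (hzero (star a))
  exact ⟨w, c, hw, hc, hcomm, hec, hcf⟩

theorem IsBaerStar.exists_central_separation_of_map {B G : Type*} [NonUnitalRing B] [StarRing B]
    [FunLike G A B] [NonUnitalRingHomClass G A B] [StarHomClass G A B] (hA : IsBaerStar A)
    (hPI : HasPartialIsometries A) (φ : G) (he : IsStarProjection e) (hf : IsStarProjection f)
    (hef : e * f = 0) (hφ : ∀ a, φ (f * a * e) = 0) :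
    ∃ c : A, IsStarProjection c ∧ (∀ a, Commute c a) ∧ φ e * φ c = φ e ∧ φ c * φ f = 0 := by
  obtain ⟨w, c, hw, hc, hcomm, hec, hcf⟩ := hA.exists_comparison hPI he hf hef
  have hφw : φ w = 0 := by simpa only [hw.mul_left_eq, hw.mul_right_eq] using hφ w
  refine ⟨c, hc, hcomm, ?_, ?_⟩
  · simpa [hφw] using congrArg φ hec
  · simpa [hφw] using congrArg φ hcf

theorem IsBaerStar.exists_central_cut_of_map {B G : Type*} [NonUnitalRing B] [StarRing B]
    [FunLike G A B] [NonUnitalRingHomClass G A B] [StarHomClass G A B] (hA : IsBaerStar A)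
    (hPI : HasPartialIsometries A) (φ : G) {a b d : A} (hb : IsSelfAdjoint b) (hab : a * b = a)
    (hbd : b * d = b) (hφ : ∀ x, Commute (φ b) (φ x)) :
    ∃ c : A, IsStarProjection c ∧ (∀ x, Commute c x) ∧ φ a * φ c = φ a ∧ φ c * φ d = φ c := by
  obtain ⟨u, hu, unit_mul⟩ := hA.exists_unit
  obtain ⟨e, he⟩ := hA.exists_isRightSupport {a}
  obtain ⟨q, hq⟩ := hA.exists_isRightSupport {b}
  have a_mul_e : a * e = a := he.mul_eq a rfl
  have b_mul_q : b * q = b := hq.mul_eq b rfl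
  have q_mul_b : q * b = b := by
    simpa only [hb.star_eq] using (mul_star_eq_star_iff (v := b) hq.isSelfAdjoint).2 b_mul_q
  have q_mul_d : q * d = q := hq.mul_right_eq <| by simpa using hbd
  have e_mul_b : e * b = e := he.mul_right_eq <| by simpa using hab
  have b_mul_e : b * e = e := by
    simpa only [he.isSelfAdjoint.star_eq] using (mul_star_eq_star_iff (v := e) hb).2 e_mul_b
  have e_mul_q : e * q = e := by rw [← e_mul_b, mul_assoc, b_mul_q]
  have map_corner_eq_zero (x : A) : φ ((u - q) * x * e) = 0 := calc
    φ ((u - q) * x * e) = φ (u - q) * (φ x * φ b) * φ e := by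
      rw [← map_mul φ x, ← map_mul, ← map_mul, ← mul_assoc, mul_assoc _ b, b_mul_e]
    _ = φ ((u - q) * b) * φ x * φ e := by rw [← (hφ x).eq, ← mul_assoc, map_mul]
    _ = 0 := by rw [sub_mul, (unit_mul b).1, q_mul_b, sub_self, map_zero, zero_mul, zero_mul]
  obtain ⟨c, hc, hcomm, hec, hcq⟩ := hA.exists_central_separation_of_map hPI φ he.isStarProjection
    (hq.isStarProjection.sub_of_mul_eq_left hu (unit_mul q).2)
    (by rw [mul_sub, (unit_mul e).2, e_mul_q, sub_self]) map_corner_eq_zero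
  refine ⟨c, hc, hcomm, ?_, ?_⟩
  · rw [← a_mul_e, map_mul, mul_assoc, hec]
  · have : φ c = φ c * φ q := by
      rwa [map_sub, mul_sub, ← map_mul, (unit_mul c).2, sub_eq_zero] at hcq
    rw [this, mul_assoc, ← map_mul, q_mul_d]

end Comparison

section Subalgebras

variable {A : Type*} [NonUnitalRing A] [StarRing A] [Module ℂ A]

theorem realPart_mem [StarModule ℂ A] {B : NonUnitalStarSubalgebra ℂ A} {x : A} (hx : x ∈ B) :
    (realPart x : A) ∈ B := by
  rw [realPart_apply_coe, ← Complex.coe_smul]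
  exact SMulMemClass.smul_mem _ (add_mem hx (star_mem hx))

theorem imaginaryPart_mem [StarModule ℂ A] {B : NonUnitalStarSubalgebra ℂ A} {x : A}
    (hx : x ∈ B) : (imaginaryPart x : A) ∈ B := by
  rw [imaginaryPart_apply_coe, ← Complex.coe_smul]
  exact SMulMemClass.smul_mem _ (SMulMemClass.smul_mem _ (sub_mem hx (star_mem hx)))

theorem le_of_forall_isSelfAdjoint [StarModule ℂ A] {B C : NonUnitalStarSubalgebra ℂ A}
    (h : ∀ x ∈ B, IsSelfAdjoint x → x ∈ C) : B ≤ C := fun x hx => by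
  rw [← realPart_add_I_smul_imaginaryPart x]
  exact add_mem (h _ (realPart_mem hx) (realPart x).2)
    (SMulMemClass.smul_mem _ (h _ (imaginaryPart_mem hx) (imaginaryPart x).2))

variable [IsScalarTower ℂ A A] [SMulCommClass ℂ A A]

theorem mem_centralizer_coe_iff {B : NonUnitalStarSubalgebra ℂ A} {x : A} :
    x ∈ NonUnitalStarSubalgebra.centralizer ℂ (B : Set A) ↔ ∀ b ∈ B, b * x = x * b := by
  rw [NonUnitalStarSubalgebra.mem_centralizer_iff]
  exact ⟨fun h b hb => (h b hb).1, fun h b hb => ⟨h b hb, h _ (star_mem hb)⟩⟩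

theorem map_mem_centralizer {B G : Type*} [NonUnitalRing B] [StarRing B] [Module ℂ B]
    [IsScalarTower ℂ B B] [SMulCommClass ℂ B B] [FunLike G A B] [NonUnitalRingHomClass G A B]
    [StarHomClass G A B] (φ : G) {T : Set A} {x : A}
    (hx : x ∈ NonUnitalStarSubalgebra.centralizer ℂ T) :
    φ x ∈ NonUnitalStarSubalgebra.centralizer ℂ (φ '' T) := by
  rw [NonUnitalStarSubalgebra.mem_centralizer_iff] at hx ⊢
  rintro _ ⟨t, ht, rfl⟩
  simp only [← map_star, ← map_mul, hx t ht, and_self]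

theorem IsBaerStar.isBaerStarSubalgebra_centralizer (hA : IsBaerStar A) (T : Set A) :
    IsBaerStarSubalgebra (NonUnitalStarSubalgebra.centralizer ℂ T) := by
  intro S hS _
  obtain ⟨p, hp⟩ := hA.exists_isRightSupport S
  refine ⟨p, NonUnitalStarSubalgebra.mem_centralizer_iff ℂ |>.2 fun t ht => ?_,
    hp.isStarProjection, hp.rightAnnihilator_eq⟩
  have hSt (s : A) (hs : s ∈ S) : Commute s t ∧ Commute s (star t) :=
    (NonUnitalStarSubalgebra.mem_centralizer_iff ℂ |>.1 (hS hs) t ht).imp Eq.symm Eq.symm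
  have hpt : Commute p t := hp.commute (fun s hs => (hSt s hs).1) fun s hs => (hSt s hs).2
  have hpt' : Commute p (star t) := by simpa [hp.isSelfAdjoint.star_eq] using hpt.star_star
  exact ⟨hpt.eq.symm, hpt'.eq.symm⟩

theorem mem_starCorner_iff {e x : A} (he : IsStarProjection e) :
    x ∈ starCorner e he ↔ e * x * e = x := by
  refine ⟨?_, fun h => ⟨x, h.symm⟩⟩
  rintro ⟨a, rfl⟩
  rw [mul_assoc e a e, he.isIdempotentElem.mul_self_mul, ← mul_assoc,
    he.isIdempotentElem.mul_mul_self]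

theorem map_mem_starCorner {B G : Type*} [NonUnitalRing B] [StarRing B] [Module ℂ B]
    [IsScalarTower ℂ B B] [SMulCommClass ℂ B B] [FunLike G A B] [NonUnitalRingHomClass G A B]
    [StarHomClass G A B] (φ : G) {e x : A} {he : IsStarProjection e} (hx : x ∈ starCorner e he) :
    φ x ∈ starCorner (φ e) (he.map φ) := by
  rw [mem_starCorner_iff] at hx ⊢
  rw [← map_mul, ← map_mul, hx]

theorem IsBaerStar.isBaerStarSubalgebra_starCorner (hA : IsBaerStar A) {e : A}
    (he : IsStarProjection e) : IsBaerStarSubalgebra (starCorner e he) := by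
  intro S hS _
  obtain ⟨p, hp⟩ := hA.exists_isRightSupport S
  have p_mul_e : p * e = p := hp.mul_right_eq fun s hs => by
    rw [← (mem_starCorner_iff he).1 (hS hs), he.isIdempotentElem.mul_mul_self]
  have e_mul_p : e * p = p := by
    simpa [hp.isSelfAdjoint.star_eq, he.isSelfAdjoint.star_eq] using congrArg star p_mul_e
  exact ⟨p, (mem_starCorner_iff he).2 (by rw [e_mul_p, p_mul_e]), hp.isStarProjection,
    hp.rightAnnihilator_eq⟩

theorem IsMaximalCommutative.centralizer_eq [StarModule ℂ A] {B : NonUnitalStarSubalgebra ℂ A}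
    (hB : IsMaximalCommutative B) : NonUnitalStarSubalgebra.centralizer ℂ (B : Set A) = B := by
  refine le_antisymm (le_of_forall_isSelfAdjoint fun y hyB hy => ?_)
    fun b hb => mem_centralizer_coe_iff.2 fun a ha => hB.prop a ha b hb
  rw [mem_centralizer_coe_iff] at hyB
  have comm : ∀ a ∈ insert y (B : Set A), ∀ b ∈ insert y (B : Set A), a * b = b * a := by
    rintro a (rfl | ha) b (rfl | hb)
    exacts [rfl, (hyB b hb).symm, hyB a ha, hB.prop a ha b hb]
  have star_mem' : ∀ b ∈ insert y (B : Set A), star b ∈ insert y (B : Set A) := by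
    rintro b (rfl | hb)
    exacts [.inl hy.star_eq, .inr (star_mem hb)]
  have subset := NonUnitalStarAlgebra.subset_adjoin ℂ (insert y (B : Set A))
  have := NonUnitalStarAlgebra.isMulCommutative_adjoin ℂ comm
    fun a ha b hb => comm a ha _ (star_mem' b hb)
  refine hB.le_of_ge (fun a ha b hb => ?_) ((Set.subset_insert y _).trans subset)
    (subset (Set.mem_insert y _))
  exact setLike_mul_comm ha hb

end Subalgebras

section Closed

variable {M : Type*} [NonUnitalCStarAlgebra M]

theorem isClosed_centralizer (T : Set M) :
    IsClosed (NonUnitalStarSubalgebra.centralizer ℂ T : Set M) := by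
  rw [NonUnitalStarSubalgebra.coe_centralizer]
  exact Set.isClosed_centralizer _

theorem isClosed_starCorner {e : M} (he : IsStarProjection e) :
    IsClosed (starCorner e he : Set M) := by
  have : (starCorner e he : Set M) = {x | e * x * e = x} := Set.ext fun x => mem_starCorner_iff he
  rw [this]
  exact isClosed_eq (by fun_prop) continuous_id

theorem IsAWStar.centralizer (hM : IsAWStar M) (T : Set M) :
    IsAWStarSubalgebra (NonUnitalStarSubalgebra.centralizer ℂ T) :=
  ⟨isClosed_centralizer T, IsBaerStar.isBaerStarSubalgebra_centralizer hM T⟩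

theorem IsAWStar.center (hM : IsAWStar M) :
    IsAWStarSubalgebra (NonUnitalStarSubalgebra.center ℂ M) := by
  rw [← NonUnitalStarSubalgebra.centralizer_univ]
  exact hM.centralizer _

theorem IsAWStar.isMaximalCommutative (hM : IsAWStar M) {B : NonUnitalStarSubalgebra ℂ M}
    (hB : IsMaximalCommutative B) : IsAWStarSubalgebra B := by
  rw [← hB.centralizer_eq]
  exact hM.centralizer _

theorem IsAWStar.starCorner (hM : IsAWStar M) {e : M} (he : IsStarProjection e) :
    IsAWStarSubalgebra (starCorner e he) :=
  ⟨isClosed_starCorner he, IsBaerStar.isBaerStarSubalgebra_starCorner hM he⟩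

end Closed

section StarOrdered

variable {R : Type*} [NonUnitalRing R] [StarRing R] [PartialOrder R] [StarOrderedRing R]

theorem isStarProjection_le_mul_self {p j : R}
    (hp : IsStarProjection p) (hj : IsSelfAdjoint j) (h : p * j = p) : p ≤ j * j := by
  have h' : j * p = p := by
    simpa [hp.isSelfAdjoint.star_eq, hj.star_eq] using congrArg star h
  have key : star (j - p) * (j - p) = j * j - p := by
    rw [star_sub, hj.star_eq, hp.isSelfAdjoint.star_eq, sub_mul, mul_sub, mul_sub, h', h,
      hp.isIdempotentElem.eq, sub_self, sub_zero]
  rw [← sub_nonneg, ← key]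
  exact star_mul_self_nonneg _

theorem le_isStarProjection_of_mul_eq {p h j : R}
    (hp : IsStarProjection p) (hh : IsSelfAdjoint h) (hle : h ≤ j) (hph : p * h = h)
    (hpj : p * j = p) : h ≤ p := by
  have hhp : h * p = h := by
    simpa [hp.isSelfAdjoint.star_eq, hh.star_eq] using congrArg star hph
  have := star_left_conjugate_le_conjugate hle p
  rwa [hp.isSelfAdjoint.star_eq, hph, hhp, hpj, hp.isIdempotentElem.eq] at this

end StarOrdered

section CStarAlgebra

open scoped ContinuousMapZero NNReal

variable {M : Type*} [NonUnitalCStarAlgebra M]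

/-- The cutoff function that vanishes up to `n s`, equals `1` from `(n + 1) s` on and is affine in
between. It serves as a continuous substitute for the spectral projection of `[(n + 1) s, ∞)`. -/
noncomputable def ramp (s : ℝ) (n : ℕ) : C(ℝ, ℝ)₀ where
  toFun t := max 0 (min (t / s - n) 1)
  map_zero' := by simp

theorem ramp_apply (s : ℝ) (n : ℕ) (t : ℝ) : ramp s n t = max 0 (min (t / s - n) 1) := rfl

theorem ramp_nonneg (s : ℝ) (n : ℕ) (t : ℝ) : 0 ≤ ramp s n t := le_max_left _ _

theorem ramp_le_one (s : ℝ) (n : ℕ) (t : ℝ) : ramp s n t ≤ 1 :=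
  max_le zero_le_one (min_le_right _ _)

theorem ramp_succ_mul_ramp (s : ℝ) (n : ℕ) : ramp s (n + 1) * ramp s n = ramp s (n + 1) := by
  ext t
  simp only [ContinuousMapZero.coe_mul, Pi.mul_apply, ramp_apply, Nat.cast_add, Nat.cast_one]
  rcases le_total (t / s) (n + 1) with h | h
  · rw [max_eq_left ((min_le_left _ _).trans (by linarith)), zero_mul]
  · rw [min_eq_right (by linarith : 1 ≤ t / s - n), max_eq_right zero_le_one, mul_one]

theorem ramp_antitone (s : ℝ) {m n : ℕ} (h : m ≤ n) (t : ℝ) : ramp s n t ≤ ramp s m t :=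
  max_le_max le_rfl (min_le_min (sub_le_sub_left (Nat.cast_le.2 h) _) le_rfl)

theorem mul_ramp_zero_mul_self_le {s t : ℝ} (hs : 0 < s) (ht : 0 ≤ t) :
    s * (ramp s 0 t * ramp s 0 t) ≤ t := by
  have hle : ramp s 0 t ≤ t / s := by simp [ramp_apply, div_nonneg ht hs.le]
  calc s * (ramp s 0 t * ramp s 0 t) ≤ s * (t / s * 1) := by
        gcongr
        exacts [ramp_nonneg .., ramp_le_one ..]
    _ = t := by rw [mul_one, mul_div_cancel₀ _ hs.ne']

theorem abs_sub_mul_ramp_two_le {s t : ℝ} (hs : 0 < s) (ht : 0 ≤ t) (hts : t ≤ 3 * s) :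
    |t - s * ramp s 2 t| ≤ 2 * s := by
  have hramp : s * ramp s 2 t = max 0 (t - 2 * s) := by
    have : t / s - 2 ≤ 1 := by rw [sub_le_iff_le_add, div_le_iff₀ hs]; linarith
    rw [ramp_apply, Nat.cast_ofNat, min_eq_left this, mul_max_of_nonneg _ _ hs.le, mul_zero,
      mul_sub, mul_div_cancel₀ _ hs.ne', mul_comm s]
  rw [hramp, abs_le]
  rcases max_cases 0 (t - 2 * s) with ⟨h, _⟩ | ⟨h, _⟩ <;> rw [h] <;> constructor <;> linarith

/-- The function that truncates real numbers to the interval `[-δ, δ]`. -/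
def clamp (δ : ℝ≥0) : C(ℝ, ℝ)₀ where
  toFun t := max (-δ) (min δ t)
  map_zero' := by simp

theorem cfcₙ_clamp_eq_self {a : M} (ha : IsSelfAdjoint a) {δ : ℝ≥0} (h : ‖a‖₊ ≤ δ) :
    cfcₙ (clamp δ) a = a := by
  conv_rhs => rw [← cfcₙ_id' ℝ a ha]
  refine cfcₙ_congr fun t ht => ?_
  have habs : |t| ≤ (δ : ℝ) :=
    (NonUnitalIsometricContinuousFunctionalCalculus.norm_quasispectrum_le a ht ha).trans h
  obtain ⟨h1, h2⟩ := abs_le.1 habs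
  change max (-(δ : ℝ)) (min δ t) = t
  rw [min_eq_right h2, max_eq_right h1]

theorem norm_cfcₙ_clamp_le (a : M) (δ : ℝ≥0) : ‖cfcₙ (clamp δ) a‖ ≤ δ :=
  norm_cfcₙ_le fun _ _ => abs_le.2
    ⟨le_max_left _ _, max_le (neg_le_self δ.coe_nonneg) (min_le_left _ _)⟩

theorem cfcₙ_ramp_ne_zero [PartialOrder M] [StarOrderedRing M] {a : M} (ha : 0 ≤ a) {s : ℝ}
    (hs : 0 < s) {n : ℕ} (h : n * s < ‖a‖) : cfcₙ (ramp s n) a ≠ 0 := by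
  intro h0
  have le_of_mem (t : ℝ) (ht : t ∈ quasispectrum ℝ a) : t ≤ n * s := by
    have hle := norm_apply_le_norm_cfcₙ (ramp s n) a ht
    rw [h0, norm_zero, norm_le_zero_iff, ramp_apply, max_eq_left_iff] at hle
    have : t / s - n ≤ 0 := (min_le_iff.1 hle).resolve_right (by norm_num)
    rwa [sub_nonpos, div_le_iff₀ hs] at this
  refine h.not_ge ?_
  rw [← cfcₙ_id' ℝ a]
  refine norm_cfcₙ_le fun t ht => ?_
  rw [Real.norm_of_nonneg (quasispectrum_nonneg_of_nonneg a ha t ht)]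
  exact le_of_mem t ht

theorem nonneg_sub_smul_and_norm_le [PartialOrder M] [StarOrderedRing M] {z p : M} {s : ℝ}
    (hs : 0 < s) (hz : 0 ≤ z) (hzs : ‖z‖ ≤ 3 * s) (hp : IsStarProjection p)
    (hp₂ : p * cfcₙ (ramp s 2) z = cfcₙ (ramp s 2) z) (hp₀ : p * cfcₙ (ramp s 0) z = p) :
    0 ≤ z - s • p ∧ ‖z - s • p‖ ≤ 2 * s := by
  have hzsa := IsSelfAdjoint.of_nonneg hz
  have spectrum_bounds (t : ℝ) (ht : t ∈ quasispectrum ℝ z) : 0 ≤ t ∧ t ≤ 3 * s :=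
    ⟨quasispectrum_nonneg_of_nonneg z hz t ht, (le_abs_self t).trans <|
      (NonUnitalIsometricContinuousFunctionalCalculus.norm_quasispectrum_le z ht hzsa).trans hzs⟩
  have smul_le : s • p ≤ z := calc
    s • p ≤ s • (cfcₙ (ramp s 0) z * cfcₙ (ramp s 0) z) :=
      smul_le_smul_of_nonneg_left (isStarProjection_le_mul_self hp (cfcₙ_predicate _ z) hp₀) hs.le
    _ = cfcₙ (fun t => s * (ramp s 0 t * ramp s 0 t)) z := by
      rw [← cfcₙ_mul _ _ z, ← cfcₙ_const_mul s _ z]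
    _ ≤ cfcₙ (fun t : ℝ => t) z :=
      cfcₙ_mono fun t ht => mul_ramp_zero_mul_self_le hs (spectrum_bounds t ht).1
    _ = z := cfcₙ_id' ℝ z
  have smul_ge : s • cfcₙ (ramp s 2) z ≤ s • p := by
    refine smul_le_smul_of_nonneg_left ?_ hs.le
    exact le_isStarProjection_of_mul_eq hp (cfcₙ_predicate _ z)
      (cfcₙ_mono fun t _ => ramp_antitone s (Nat.zero_le 2) t) hp₂ hp₀
  refine ⟨sub_nonneg.2 smul_le, ?_⟩
  calc ‖z - s • p‖ ≤ ‖z - s • cfcₙ (ramp s 2) z‖ :=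
        CStarAlgebra.norm_le_norm_of_nonneg_of_le (sub_nonneg.2 smul_le)
          (sub_le_sub_left smul_ge z)
    _ = ‖cfcₙ (fun t => t - s * ramp s 2 t) z‖ := by
        rw [cfcₙ_sub _ _ z, cfcₙ_id' ℝ z, cfcₙ_const_mul s _ z]
    _ ≤ 2 * s := norm_cfcₙ_le fun t ht =>
        abs_sub_mul_ramp_two_le hs (spectrum_bounds t ht).1 (spectrum_bounds t ht).2

end CStarAlgebra

namespace ProjectiveLimit

open scoped ContinuousMapZero

variable {A : Type*} [NonUnitalRing A] [StarRing A] [Module ℂ A] [TopologicalSpace A]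
  {Λ : Type*} [PartialOrder Λ] {F : Λ → Type*}

section TopologicalFactors

variable [∀ α, NonUnitalRing (F α)] [∀ α, StarRing (F α)] [∀ α, Module ℂ (F α)]
  [∀ α, TopologicalSpace (F α)] (D : ProjectiveLimit A F)

theorem ext {x y : A} (h : ∀ α, D.π α x = D.π α y) : x = y :=
  D.isEmbedding.injective (funext h)

theorem continuous_π (α : Λ) : Continuous (D.π α) :=
  continuous_pi_iff.1 D.isEmbedding.continuous α

end TopologicalFactors

variable [∀ α, NonUnitalCStarAlgebra (F α)] (D : ProjectiveLimit A F)

theorem exists_π_eq_cfcₙ {x : A} (hx : IsSelfAdjoint x) (f : C(ℝ, ℝ)₀) :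
    ∃ y : A, ∀ α, D.π α y = cfcₙ f (D.π α x) := by
  refine D.exists_lift _ fun α β h => ?_
  rw [NonUnitalStarAlgHom.map_cfcₙ (D.g α β h) f (D.π β x) (map_continuous f).continuousOn
    (map_zero f) (D.g_continuous α β h) (hx.map _) ((hx.map _).map _), D.g_π]

/-- The continuous functional calculus of a self-adjoint element of a projective limit of
`C*`-algebras, computed in each factor. As the factors need not be unital, the functions are
required to vanish at `0`. -/
noncomputable def fcalc {x : A} (hx : IsSelfAdjoint x) (f : C(ℝ, ℝ)₀) : A :=
  (D.exists_π_eq_cfcₙ hx f).choose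

section FunctionalCalculus

variable {x : A} (hx : IsSelfAdjoint x)

theorem π_fcalc (f : C(ℝ, ℝ)₀) (α : Λ) : D.π α (D.fcalc hx f) = cfcₙ f (D.π α x) :=
  (D.exists_π_eq_cfcₙ hx f).choose_spec α

theorem isSelfAdjoint_fcalc (f : C(ℝ, ℝ)₀) : IsSelfAdjoint (D.fcalc hx f) :=
  D.ext fun α => by
    rw [map_star, D.π_fcalc hx]
    exact cfcₙ_predicate f (D.π α x)

theorem fcalc_mul (f g : C(ℝ, ℝ)₀) : D.fcalc hx (f * g) = D.fcalc hx f * D.fcalc hx g :=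
  D.ext fun α => by
    rw [map_mul, D.π_fcalc hx, D.π_fcalc hx, D.π_fcalc hx, ContinuousMapZero.coe_mul]
    exact cfcₙ_mul _ _ _

theorem fcalc_id : D.fcalc hx ⟨.id ℝ, rfl⟩ = x :=
  D.ext fun α => (D.π_fcalc hx _ α).trans (cfcₙ_id' ℝ _ (hx.map _))

end FunctionalCalculus

/-- The function `t ↦ √t / max t ε`, which agrees with `1 / √t` for `t ≥ ε`. -/
noncomputable def invSqrtAbove {ε : ℝ} (hε : 0 < ε) : C(ℝ, ℝ)₀ where
  toFun t := √t / max t ε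
  continuous_toFun := Real.continuous_sqrt.div (by fun_prop) fun _ => (lt_max_of_lt_right hε).ne'
  map_zero' := by simp

theorem ramp_one_mul_invSqrtAbove {ε : ℝ} (hε : 0 < ε) :
    ramp ε 1 * (invSqrtAbove hε * ⟨.id ℝ, rfl⟩ * invSqrtAbove hε) = ramp ε 1 := by
  ext t
  change ramp ε 1 t * (√t / max t ε * t * (√t / max t ε)) = ramp ε 1 t
  rcases le_total t ε with ht | ht
  · have hle : t / ε - (1 : ℕ) ≤ 0 := by
      rw [Nat.cast_one, sub_nonpos]
      exact div_le_one_of_le₀ ht hε.le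
    rw [ramp_apply, max_eq_left ((min_le_left _ _).trans hle), zero_mul]
  · have ht0 : 0 < t := hε.trans_le ht
    have : √t / t * t * (√t / t) = 1 := by
      rw [div_mul_cancel₀ _ ht0.ne', ← mul_div_assoc, Real.mul_self_sqrt ht0.le, div_self ht0.ne']
    rw [max_eq_left ht, this, mul_one]

theorem exists_cutoff_inverse {y : A} (hy : IsSelfAdjoint y) [∀ α, PartialOrder (F α)]
    [∀ α, StarOrderedRing (F α)] {α : Λ} (hα : 0 ≤ D.π α y) (hne : D.π α y ≠ 0) :
    ∃ h k : A, h ≠ 0 ∧ IsSelfAdjoint k ∧ Commute k y ∧ h * (k * y * k) = h := by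
  set ε := ‖D.π α y‖ / 2 with hε_def
  have hε : 0 < ε := half_pos (norm_pos_iff.2 hne)
  refine ⟨D.fcalc hy (ramp ε 1), D.fcalc hy (invSqrtAbove hε), fun h0 => ?_,
    D.isSelfAdjoint_fcalc hy _, ?_, ?_⟩
  · refine cfcₙ_ramp_ne_zero hα hε (n := 1) (by rw [Nat.cast_one]; linarith) ?_
    rw [← D.π_fcalc hy, h0, map_zero]
  · have := congrArg (D.fcalc hy) (mul_comm (invSqrtAbove hε) ⟨.id ℝ, rfl⟩)
    rwa [D.fcalc_mul, D.fcalc_mul, D.fcalc_id] at this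
  · simpa only [D.fcalc_mul, D.fcalc_id] using
      congrArg (D.fcalc hy) (ramp_one_mul_invSqrtAbove hε)

theorem hasPartialIsometries (D : ProjectiveLimit A F) (hA : IsBaerStar A) :
    HasPartialIsometries A := by
  let _ : ∀ α, PartialOrder (F α) := fun α => CStarAlgebra.spectralOrder (F α)
  have _ : ∀ α, StarOrderedRing (F α) := fun α => CStarAlgebra.spectralOrderedRing (F α)
  rintro e f he hf ⟨a, ha⟩
  set x := f * a * e with hx
  have f_mul_x : f * x = x := by
    rw [hx, ← mul_assoc, ← mul_assoc, hf.isIdempotentElem.eq]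
  have x_mul_e : x * e = x := by rw [hx, mul_assoc, he.isIdempotentElem.eq]
  obtain ⟨α, hα⟩ : ∃ α, D.π α x ≠ 0 := by
    by_contra! h
    exact ha (D.ext fun α => by rw [h α, map_zero])
  have hπ : D.π α (star x * x) = star (D.π α x) * D.π α x := by rw [map_mul, map_star]
  obtain ⟨h, k, hne, hk, hkx, h_mul⟩ := D.exists_cutoff_inverse (IsSelfAdjoint.star_mul_self x)
    (hπ ▸ star_mul_self_nonneg _) (hπ ▸ CStarRing.star_mul_self_ne_zero_iff _ |>.2 hα)
  have h_mul_e : h * e = h := calc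
    h * e = h * (k * (k * (star x * (x * e)))) := by
      conv_lhs => rw [← h_mul, mul_assoc k, ← hkx.eq]
      simp only [mul_assoc]
    _ = h := by rw [x_mul_e, hkx.eq, ← mul_assoc k, h_mul]
  obtain ⟨g, hg⟩ := hA.exists_isRightSupport {h}
  have g_mul : g * (k * (star x * x) * k) = g := hg.mul_right_eq <| by
    rintro _ rfl
    exact h_mul
  have g_mul_e : g * e = g := hg.mul_right_eq <| by
    rintro _ rfl
    exact h_mul_e
  have star_mul_self_eq : star (x * k * g) * (x * k * g) = g := calc
    _ = g * (k * (star x * x) * k) * g := by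
      simp only [star_mul, hk.star_eq, hg.isSelfAdjoint.star_eq, mul_assoc]
    _ = g := by rw [g_mul, hg.isStarProjection.isIdempotentElem.eq]
  refine ⟨x * k * g, fun h0 => hne ?_, ?_, ?_, ?_⟩
  · rw [← hg.mul_eq h rfl, ← star_mul_self_eq, h0, mul_zero, mul_zero]
  · rw [← mul_assoc, ← mul_assoc, f_mul_x]
  · rw [mul_assoc, g_mul_e]
  · rw [mul_assoc, star_mul_self_eq, mul_assoc, hg.isStarProjection.isIdempotentElem.eq]

end ProjectiveLimit

namespace ProjectiveLimit

variable {A : Type*} [NonUnitalRing A] [StarRing A] [Module ℂ A] [TopologicalSpace A]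
  {Λ : Type*} [PartialOrder Λ] {F : Λ → Type*} [∀ α, NonUnitalCStarAlgebra (F α)]
  (D : ProjectiveLimit A F)

/-- The restriction of a projective limit to subalgebras of the limit and of the factors. -/
def restrict (B : NonUnitalStarSubalgebra ℂ A) (C : ∀ α, NonUnitalStarSubalgebra ℂ (F α))
    (hg : ∀ α β (h : α ≤ β), ∀ x ∈ C β, D.g α β h x ∈ C α)
    (hB : ∀ x, x ∈ B ↔ ∀ α, D.π α x ∈ C α) : ProjectiveLimit B (fun α => C α) where
  g α β h := NonUnitalStarAlgHom.codRestrict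
    ((D.g α β h).comp (NonUnitalStarSubalgebraClass.subtype (C β))) (C α) fun x => hg α β h x x.2
  g_continuous α β h := ((D.g_continuous α β h).comp continuous_subtype_val).subtype_mk _
  g_refl α x := Subtype.ext (D.g_refl α x)
  g_comp α β γ h k x := Subtype.ext (D.g_comp α β γ h k x)
  π α := NonUnitalStarAlgHom.codRestrict
    ((D.π α).comp (NonUnitalStarSubalgebraClass.subtype B)) (C α) fun x => (hB x).1 x.2 α
  g_π α β h a := Subtype.ext (D.g_π α β h a)
  isEmbedding := by
    refine Topology.IsEmbedding.of_comp (g := fun (x : (α : Λ) → C α) (α : Λ) => (x α : F α))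
      ?_ ?_ ?_
    · exact continuous_pi fun α => ((D.continuous_π α).comp continuous_subtype_val).subtype_mk _
    · exact continuous_pi fun α => continuous_subtype_val.comp (continuous_apply α)
    · exact D.isEmbedding.comp Topology.IsEmbedding.subtypeVal
  exists_lift x hx := by
    obtain ⟨a, ha⟩ := D.exists_lift (fun α => (x α : F α)) fun α β h =>
      congrArg Subtype.val (hx α β h)
    exact ⟨⟨a, (hB a).2 fun α => by rw [ha]; exact (x α).2⟩, fun α => Subtype.ext (ha α)⟩

theorem restrictsTo {B : NonUnitalStarSubalgebra ℂ A} {C : ∀ α, NonUnitalStarSubalgebra ℂ (F α)}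
    (hg : ∀ α β (h : α ≤ β), ∀ x ∈ C β, D.g α β h x ∈ C α)
    (hB : ∀ x, x ∈ B ↔ ∀ α, D.π α x ∈ C α) : D.RestrictsTo B C :=
  ⟨D.restrict B C hg hB, fun _ _ _ _ => rfl, fun _ _ => rfl⟩

theorem g_mem_map {B : NonUnitalStarSubalgebra ℂ A} {α β : Λ} (h : α ≤ β) {x : F β}
    (hx : x ∈ B.map (D.π β)) : D.g α β h x ∈ B.map (D.π α) := by
  obtain ⟨b, hb, rfl⟩ := hx
  exact ⟨b, hb, (D.g_π α β h b).symm⟩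

/-- A `*`-subalgebra `B` of `lim F α` is factorwise closed if it contains each element whose
components lie in the closures of the images of `B` in the factors. -/
def IsFactorwiseClosed (B : NonUnitalStarSubalgebra ℂ A) : Prop :=
  ∀ x, (∀ α, D.π α x ∈ (B.map (D.π α)).topologicalClosure) → x ∈ B

variable {D} in
theorem isFactorwiseClosed_of_isClosed {B : NonUnitalStarSubalgebra ℂ A}
    {C : ∀ α, NonUnitalStarSubalgebra ℂ (F α)} (hC : ∀ α, IsClosed (C α : Set (F α)))
    (hB : ∀ x, x ∈ B ↔ ∀ α, D.π α x ∈ C α) : D.IsFactorwiseClosed B := fun x hx =>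
  (hB x).2 fun α => (hC α).closure_subset_iff.2
    (by rintro _ ⟨b, hb, rfl⟩; exact (hB b).1 hb α) (hx α)

namespace IsFactorwiseClosed

variable {D} {B : NonUnitalStarSubalgebra ℂ A}

theorem restrictsTo_map (hB : D.IsFactorwiseClosed B) : D.RestrictsTo B fun α => B.map (D.π α) :=
  D.restrictsTo (fun _ _ h _ => D.g_mem_map h) fun x =>
    ⟨fun hx _ => ⟨x, hx, rfl⟩, fun hx => hB x fun α => subset_closure (hx α)⟩

theorem fcalc_mem (hB : D.IsFactorwiseClosed B) {x : A} (hx : IsSelfAdjoint x) (hxB : x ∈ B)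
    (f : ContinuousMapZero ℝ ℝ) : D.fcalc hx f ∈ B := hB _ fun α => by
  rw [D.π_fcalc hx]
  have : IsClosed ((B.map (D.π α)).topologicalClosure : Set (F α)) :=
    NonUnitalStarSubalgebra.isClosed_topologicalClosure _
  exact cfcₙ_mem f (subset_closure ⟨x, hxB, rfl⟩)

-- Truncating the real and the imaginary part of `b` at `‖π α b‖` does not change `π α b`.
theorem exists_mem_π_eq_and_norm_le [StarModule ℂ A] (hB : D.IsFactorwiseClosed B) {b : A}
    (hb : b ∈ B) (α : Λ) :
    ∃ b' ∈ B, D.π α b' = D.π α b ∧ ∀ β, ‖D.π β b'‖ ≤ 2 * ‖D.π α b‖ := by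
  have hr : IsSelfAdjoint (realPart b : A) := (realPart b).2
  have hi : IsSelfAdjoint (imaginaryPart b : A) := (imaginaryPart b).2
  set δ := ‖D.π α b‖₊
  refine ⟨D.fcalc hr (clamp δ) + Complex.I • D.fcalc hi (clamp δ),
    add_mem (hB.fcalc_mem hr (realPart_mem hb) _)
      (SMulMemClass.smul_mem _ (hB.fcalc_mem hi (imaginaryPart_mem hb) _)), ?_, fun β => ?_⟩
  · have norm_re : ‖D.π α (realPart b)‖₊ ≤ δ := by
      rw [map_realPart]
      exact realPart.norm_le (D.π α b)
    have norm_im : ‖D.π α (imaginaryPart b)‖₊ ≤ δ := by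
      rw [map_imaginaryPart]
      exact imaginaryPart.norm_le (D.π α b)
    rw [map_add, map_smul, D.π_fcalc, D.π_fcalc, cfcₙ_clamp_eq_self (hr.map _) norm_re,
      cfcₙ_clamp_eq_self (hi.map _) norm_im, ← map_smul, ← map_add,
      realPart_add_I_smul_imaginaryPart]
  · rw [map_add, map_smul, D.π_fcalc, D.π_fcalc, two_mul]
    refine norm_add_le_of_le (norm_cfcₙ_clamp_le _ δ) ?_
    rw [norm_smul, Complex.norm_I, one_mul]
    exact norm_cfcₙ_clamp_le _ δ

end IsFactorwiseClosed

theorem exists_hasSum {d : ℕ → A} {δ : ℕ → ℝ} (hδ : Summable δ)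
    (hd : ∀ β n, ‖D.π β (d n)‖ ≤ δ n) : ∃ y, ∀ β, HasSum (fun n => D.π β (d n)) (D.π β y) := by
  have hsum (β : Λ) : Summable fun n => D.π β (d n) := Summable.of_norm_bounded hδ (hd β)
  obtain ⟨y, hy⟩ := D.exists_lift (fun β => ∑' n, D.π β (d n)) fun α β h => by
    have := (hsum β).hasSum.map (D.g α β h) (D.g_continuous α β h)
    refine this.unique ?_
    convert! (hsum α).hasSum using 2 with n
    exact D.g_π α β h _
  exact ⟨y, fun β => by rw [hy]; exact (hsum β).hasSum⟩

theorem IsFactorwiseClosed.isClosed_map [StarModule ℂ A] {D : ProjectiveLimit A F}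
    {B : NonUnitalStarSubalgebra ℂ A} (hB : D.IsFactorwiseClosed B) (α : Λ) :
    IsClosed (B.map (D.π α) : Set (F α)) := by
  refine isClosed_of_closure_subset fun z hz => ?_
  obtain ⟨v, tendsto_v, hv, -, norm_v⟩ := controlled_sum_of_mem_closure
    (s := (B.map (D.π α)).toNonUnitalSubalgebra.toNonUnitalSubring.toAddSubgroup) hz
    (b := fun n => (1 / 2 : ℝ) ^ n) fun n => by positivity
  choose b hbB hb using hv
  choose d hdB hdα hd using fun n => hB.exists_mem_π_eq_and_norm_le (hbB n) α
  replace hdα (n : ℕ) : D.π α (d n) = v n := (hdα n).trans (hb n)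
  have summable_d : Summable fun n => 2 * ‖D.π α (b n)‖ := by
    refine .mul_left 2 <| (summable_nat_add_iff 1).1 ?_
    refine .of_nonneg_of_le (fun _ => norm_nonneg _) (fun n => ?_)
      ((summable_nat_add_iff 1).2 summable_geometric_two)
    rw [show D.π α (b (n + 1)) = v (n + 1) from hb _]
    exact (norm_v _ n.succ_pos).le
  obtain ⟨y, hy⟩ := D.exists_hasSum summable_d fun β n => hd n β
  refine ⟨y, hB y fun β => ?_, ?_⟩
  · refine mem_closure_of_tendsto (hy β) (.of_forall fun s => ?_)
    exact sum_mem fun n _ => ⟨d n, hdB n, rfl⟩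
  · refine tendsto_nhds_unique ((hy α).tendsto_sum_nat.comp (Filter.tendsto_add_atTop_nat 1)) ?_
    simpa only [Function.comp_def, hdα] using tendsto_v

end ProjectiveLimit

theorem ProjectiveLimit.IsFactorwiseClosed.isLocallyCStar {A : Type u} [NonUnitalRing A]
    [StarRing A] [Module ℂ A] [TopologicalSpace A] {Λ : Type u} [PartialOrder Λ]
    [IsDirectedOrder Λ] {F : Λ → Type u} [∀ α, NonUnitalCStarAlgebra (F α)]
    {D : ProjectiveLimit A F} {B : NonUnitalStarSubalgebra ℂ A} (hB : D.IsFactorwiseClosed B) :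
    IsLocallyCStar B := by
  have hc (α : Λ) : IsClosed ((B.map (D.π α)).topologicalClosure : Set (F α)) :=
    NonUnitalStarSubalgebra.isClosed_topologicalClosure _
  exact ⟨Λ, inferInstance, inferInstance, fun α => (B.map (D.π α)).topologicalClosure,
    fun α => NonUnitalStarSubalgebra.nonUnitalCStarAlgebra (h_closed := hc α) _,
    ⟨D.restrict B _ (fun α β h _ hx => map_mem_closure (D.g_continuous α β h) hx fun _ =>
      D.g_mem_map h) fun x => ⟨fun hx α => subset_closure ⟨x, hx, rfl⟩, hB x⟩⟩⟩

namespace ProjectiveLimit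

variable {A : Type*} [NonUnitalRing A] [StarRing A] [Module ℂ A] [IsScalarTower ℂ A A]
  [SMulCommClass ℂ A A] [TopologicalSpace A] {Λ : Type*} [PartialOrder Λ] {F : Λ → Type*}
  [∀ α, NonUnitalCStarAlgebra (F α)] (D : ProjectiveLimit A F)

theorem mem_centralizer_iff {T : Set A} {x : A} :
    x ∈ NonUnitalStarSubalgebra.centralizer ℂ T ↔
      ∀ α, D.π α x ∈ NonUnitalStarSubalgebra.centralizer ℂ (D.π α '' T) := by
  refine ⟨fun hx α => map_mem_centralizer (D.π α) hx, fun hx => ?_⟩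
  have (α : Λ) (t : A) (ht : t ∈ T) :=
    (NonUnitalStarSubalgebra.mem_centralizer_iff ℂ).1 (hx α) _ ⟨t, ht, rfl⟩
  simp only [← map_star, ← map_mul] at this
  exact (NonUnitalStarSubalgebra.mem_centralizer_iff ℂ).2 fun t ht =>
    ⟨D.ext fun α => (this α t ht).1, D.ext fun α => (this α t ht).2⟩

theorem isFactorwiseClosed_centralizer (T : Set A) :
    D.IsFactorwiseClosed (NonUnitalStarSubalgebra.centralizer ℂ T) :=
  isFactorwiseClosed_of_isClosed (fun _ => isClosed_centralizer _) fun _ => D.mem_centralizer_iff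

theorem restrictsTo_centralizer (T : Set A) :
    D.RestrictsTo (NonUnitalStarSubalgebra.centralizer ℂ T)
      fun α => NonUnitalStarSubalgebra.centralizer ℂ (D.π α '' T) :=
  D.restrictsTo (fun α β h x hx => by
    simpa only [Set.image_image, D.g_π] using map_mem_centralizer (D.g α β h) hx)
    fun _ => D.mem_centralizer_iff

theorem restrictsTo_center (hπ : ∀ α, Function.Surjective (D.π α)) :
    D.RestrictsTo (NonUnitalStarSubalgebra.center ℂ A)
      fun α => NonUnitalStarSubalgebra.center ℂ (F α) := by
  simpa only [Set.image_univ_of_surjective (hπ _), NonUnitalStarSubalgebra.centralizer_univ] using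
    D.restrictsTo_centralizer Set.univ

theorem mem_starCorner_iff {e x : A} (he : IsStarProjection e) :
    x ∈ starCorner e he ↔ ∀ α, D.π α x ∈ starCorner (D.π α e) (he.map (D.π α)) := by
  simp only [_root_.mem_starCorner_iff, ← map_mul]
  exact ⟨fun h α => by rw [h], D.ext⟩

theorem isFactorwiseClosed_starCorner {e : A} (he : IsStarProjection e) :
    D.IsFactorwiseClosed (starCorner e he) :=
  isFactorwiseClosed_of_isClosed (fun _ => isClosed_starCorner _) fun _ => D.mem_starCorner_iff he

theorem restrictsTo_starCorner {e : A} (he : IsStarProjection e) :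
    D.RestrictsTo (starCorner e he) fun α => starCorner (D.π α e) (he.map (D.π α)) := by
  refine D.restrictsTo (fun α β h x hx => ?_) fun _ => D.mem_starCorner_iff he
  simpa only [D.g_π] using map_mem_starCorner (D.g α β h) hx

theorem map_starCorner {e : A} (he : IsStarProjection e) {α : Λ}
    (hπ : Function.Surjective (D.π α)) :
    (starCorner e he).map (D.π α) = starCorner (D.π α e) (he.map (D.π α)) := by
  refine le_antisymm ?_ ?_
  · rintro _ ⟨a, ha, rfl⟩
    exact map_mem_starCorner (D.π α) ha
  · rintro _ ⟨y, rfl⟩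
    obtain ⟨a, rfl⟩ := hπ y
    refine ⟨e * a * e, ⟨a, rfl⟩, ?_⟩
    change D.π α (e * a * e) = _
    rw [map_mul, map_mul]

theorem isFactorwiseClosed_of_isMaximalCommutative [StarModule ℂ A]
    {B : NonUnitalStarSubalgebra ℂ A} (hB : IsMaximalCommutative B) : D.IsFactorwiseClosed B := by
  rw [← hB.centralizer_eq]
  exact D.isFactorwiseClosed_centralizer _

theorem restrictsTo_centralizer_map [StarModule ℂ A] {B : NonUnitalStarSubalgebra ℂ A}
    (hB : IsMaximalCommutative B) : D.RestrictsTo B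
      fun α => NonUnitalStarSubalgebra.centralizer ℂ (B.map (D.π α) : Set (F α)) := by
  have := D.restrictsTo_centralizer (B : Set A)
  rwa [hB.centralizer_eq] at this

theorem mem_iff_of_isMaximalCommutative [StarModule ℂ A] {B : NonUnitalStarSubalgebra ℂ A}
    (hB : IsMaximalCommutative B) {C : ∀ α, NonUnitalStarSubalgebra ℂ (F α)}
    (hC : ∀ α, ∀ x ∈ C α, ∀ y ∈ C α, x * y = y * x) (hBC : ∀ α, B.map (D.π α) ≤ C α) {x : A} :
    x ∈ B ↔ ∀ α, D.π α x ∈ C α := by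
  refine ⟨fun hx α => hBC α ⟨x, hx, rfl⟩, fun hx => ?_⟩
  rw [← hB.centralizer_eq, mem_centralizer_coe_iff]
  refine fun b hb => D.ext fun α => ?_
  rw [map_mul, map_mul]
  exact hC α _ (hBC α ⟨b, hb, rfl⟩) _ (hx α)

end ProjectiveLimit

section LocallyAWStar

variable {A : Type u} [NonUnitalRing A] [StarRing A] [Module ℂ A] [IsScalarTower ℂ A A]
  [SMulCommClass ℂ A A] [StarModule ℂ A] [TopologicalSpace A]

theorem IsLocallyAWStar.centralizer (hA : IsLocallyAWStar A) (T : Set A) :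
    IsLocallyAWStarSubalgebra (NonUnitalStarSubalgebra.centralizer ℂ T) := by
  obtain ⟨⟨Λ, _, _, F, _, ⟨D⟩⟩, hA⟩ := hA
  exact ⟨(D.isFactorwiseClosed_centralizer T).isLocallyCStar,
    hA.isBaerStarSubalgebra_centralizer T⟩

theorem IsLocallyAWStar.center (hA : IsLocallyAWStar A) :
    IsLocallyAWStarSubalgebra (NonUnitalStarSubalgebra.center ℂ A) := by
  rw [← NonUnitalStarSubalgebra.centralizer_univ]
  exact hA.centralizer _

theorem IsLocallyAWStar.isMaximalCommutative (hA : IsLocallyAWStar A)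
    {B : NonUnitalStarSubalgebra ℂ A} (hB : IsMaximalCommutative B) :
    IsLocallyAWStarSubalgebra B := by
  rw [← hB.centralizer_eq]
  exact hA.centralizer _

theorem IsLocallyAWStar.starCorner (hA : IsLocallyAWStar A) {e : A} (he : IsStarProjection e) :
    IsLocallyAWStarSubalgebra (starCorner e he) := by
  obtain ⟨⟨Λ, _, _, F, _, ⟨D⟩⟩, hA⟩ := hA
  exact ⟨(D.isFactorwiseClosed_starCorner he).isLocallyCStar,
    hA.isBaerStarSubalgebra_starCorner he⟩

end LocallyAWStar

theorem mem_of_forall_exists_norm_sub_le {E : Type*} [SeminormedAddCommGroup E] {N : AddSubgroup E}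
    (hN : IsClosed (N : Set E)) {P : Set E} {r : ℝ} (hr₀ : 0 ≤ r) (hr₁ : r < 1)
    (h : ∀ z ∈ P, ∃ y ∈ N, z - y ∈ P ∧ ‖z - y‖ ≤ r * ‖z‖) {z : E} (hz : z ∈ P) : z ∈ N := by
  have approx (n : ℕ) : ∃ y ∈ N, z - y ∈ P ∧ ‖z - y‖ ≤ r ^ n * ‖z‖ := by
    induction n with
    | zero => exact ⟨0, zero_mem N, by simpa using hz, by simp⟩
    | succ n ih =>
      obtain ⟨y, hy, hyP, hyn⟩ := ih
      obtain ⟨y', hy', hyP', hyn'⟩ := h _ hyP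
      refine ⟨y + y', add_mem hy hy', by rwa [← sub_sub], ?_⟩
      calc ‖z - (y + y')‖ ≤ r * ‖z - y‖ := by rwa [← sub_sub]
        _ ≤ r * (r ^ n * ‖z‖) := by gcongr
        _ = r ^ (n + 1) * ‖z‖ := by rw [pow_succ', mul_assoc]
  choose y hyN _ hy using approx
  refine hN.mem_of_tendsto (b := Filter.atTop) (f := y) ?_ (.of_forall hyN)
  rw [tendsto_iff_norm_sub_tendsto_zero]
  refine squeeze_zero (fun _ => norm_nonneg _) (fun n => (norm_sub_rev _ _).trans_le (hy n)) ?_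
  simpa using (tendsto_pow_atTop_nhds_zero_of_lt_one hr₀ hr₁).mul_const ‖z‖

namespace ProjectiveLimit

variable {A : Type*} [NonUnitalRing A] [StarRing A] [Module ℂ A] [TopologicalSpace A]
  {Λ : Type*} [PartialOrder Λ] {F : Λ → Type*} [∀ α, NonUnitalCStarAlgebra (F α)]
  (D : ProjectiveLimit A F)

theorem exists_central_projection [StarModule ℂ A] (hA : IsBaerStar A) {α : Λ}
    [PartialOrder (F α)] [StarOrderedRing (F α)] (hπ : Function.Surjective (D.π α)) {z : F α}
    (hz : 0 ≤ z) (hzc : ∀ b, Commute z b) {s : ℝ} (hs : 0 < s) (hzs : ‖z‖ ≤ 3 * s) :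
    ∃ c : A, (∀ a, Commute c a) ∧ 0 ≤ z - s • D.π α c ∧ ‖z - s • D.π α c‖ ≤ 2 * s := by
  obtain ⟨y, rfl⟩ := hπ z
  have π_realPart : D.π α (realPart y) = D.π α y := by
    rw [map_realPart, (IsSelfAdjoint.of_nonneg hz).coe_realPart]
  have hy : IsSelfAdjoint (realPart y : A) := (realPart y).2
  have π_ramp (n : ℕ) : D.π α (D.fcalc hy (ramp s n)) = cfcₙ (ramp s n) (D.π α y) := by
    rw [D.π_fcalc, π_realPart]
  obtain ⟨c, hc, hcomm, h₂, h₀⟩ := hA.exists_central_cut_of_map (D.hasPartialIsometries hA) (D.π α)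
    (D.isSelfAdjoint_fcalc hy (ramp s 1))
    ((D.fcalc_mul hy _ _).symm.trans (congrArg _ (ramp_succ_mul_ramp s 1)))
    ((D.fcalc_mul hy _ _).symm.trans (congrArg _ (ramp_succ_mul_ramp s 0)))
    fun x => by rw [π_ramp]; exact (hzc _).cfcₙ_real _
  rw [← map_mul, ← (hcomm _).eq, map_mul, π_ramp] at h₂
  rw [π_ramp] at h₀
  exact ⟨c, hcomm, nonneg_sub_smul_and_norm_le hs hz hzs (hc.map _) h₂ h₀⟩

variable [IsScalarTower ℂ A A] [SMulCommClass ℂ A A]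

theorem map_center_le {α : Λ} (hπ : Function.Surjective (D.π α)) :
    (NonUnitalStarSubalgebra.center ℂ A).map (D.π α) ≤ NonUnitalStarSubalgebra.center ℂ (F α) := by
  rw [← NonUnitalStarSubalgebra.centralizer_univ, ← NonUnitalStarSubalgebra.centralizer_univ,
    ← Set.image_univ_of_surjective hπ]
  rintro _ ⟨c, hc, rfl⟩
  exact map_mem_centralizer (D.π α) hc

variable [StarModule ℂ A]

theorem isClosed_map_center (α : Λ) :
    IsClosed ((NonUnitalStarSubalgebra.center ℂ A).map (D.π α) : Set (F α)) := by
  rw [← NonUnitalStarSubalgebra.centralizer_univ]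
  exact (D.isFactorwiseClosed_centralizer _).isClosed_map α

theorem mem_map_center_of_nonneg (hA : IsBaerStar A) {α : Λ} [PartialOrder (F α)]
    [StarOrderedRing (F α)] (hπ : Function.Surjective (D.π α)) {z : F α} (hz : 0 ≤ z)
    (hzc : ∀ b, Commute z b) : z ∈ (NonUnitalStarSubalgebra.center ℂ A).map (D.π α) := by
  refine mem_of_forall_exists_norm_sub_le (P := {z : F α | 0 ≤ z ∧ ∀ b, Commute z b})
    (N := ((NonUnitalStarSubalgebra.center ℂ A).map
      (D.π α)).toNonUnitalSubalgebra.toNonUnitalSubring.toAddSubgroup)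
    (D.isClosed_map_center α) (r := 2 / 3) (by norm_num) (by norm_num) ?_ ⟨hz, hzc⟩
  rintro z ⟨hz, hzc⟩
  rcases eq_or_ne z 0 with rfl | hz0
  · exact ⟨0, zero_mem _, by simp, by simp⟩
  obtain ⟨c, hc, hnonneg, hnorm⟩ := D.exists_central_projection hA hπ hz hzc (s := ‖z‖ / 3)
    (div_pos (norm_pos_iff.2 hz0) three_pos) (by linarith)
  have hcmem : D.π α c ∈ (NonUnitalStarSubalgebra.center ℂ A).map (D.π α) :=
    ⟨c, NonUnitalStarSubalgebra.mem_center_iff.2 fun b => (hc b).symm.eq, rfl⟩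
  refine ⟨(‖z‖ / 3) • D.π α c, ?_, ⟨hnonneg, fun b => (hzc b).sub_left (.smul_left ?_ _)⟩,
    hnorm.trans_eq (by ring)⟩
  · rw [← Complex.coe_smul]
    exact SMulMemClass.smul_mem (s := (NonUnitalStarSubalgebra.center ℂ A).map (D.π α)) _ hcmem
  · exact (NonUnitalStarSubalgebra.mem_center_iff.1 (D.map_center_le hπ hcmem) b).symm

theorem map_center (hA : IsBaerStar A) {α : Λ} (hπ : Function.Surjective (D.π α)) :
    (NonUnitalStarSubalgebra.center ℂ A).map (D.π α) = NonUnitalStarSubalgebra.center ℂ (F α) := by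
  let _ : PartialOrder (F α) := CStarAlgebra.spectralOrder (F α)
  have _ : StarOrderedRing (F α) := CStarAlgebra.spectralOrderedRing (F α)
  refine le_antisymm (D.map_center_le hπ) (le_of_forall_isSelfAdjoint fun z hz hzsa => ?_)
  have hzc (b : F α) : Commute z b := (NonUnitalStarSubalgebra.mem_center_iff.1 hz b).symm
  rw [← CFC.posPart_sub_negPart z hzsa]
  exact sub_mem
    (D.mem_map_center_of_nonneg hA hπ (CFC.posPart_nonneg z) fun b => (hzc b).cfcₙ_real _)
    (D.mem_map_center_of_nonneg hA hπ (CFC.negPart_nonneg z) fun b => (hzc b).cfcₙ_real _)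

end ProjectiveLimit

theorem theorem2_general (A : Type u) [NonUnitalRing A] [StarRing A] [Module ℂ A]
    [IsScalarTower ℂ A A] [SMulCommClass ℂ A A] [StarModule ℂ A] [TopologicalSpace A] :
    (IsLocallyAWStar A →
      IsLocallyAWStarSubalgebra (NonUnitalStarSubalgebra.center ℂ A) ∧
      (∀ B : NonUnitalStarSubalgebra ℂ A, IsMaximalCommutative B → IsLocallyAWStarSubalgebra B) ∧
      (∀ (e : A) (he : IsStarProjection e), IsLocallyAWStarSubalgebra (starCorner e he))) ∧
    ∀ (Λ : Type v) [PartialOrder Λ] (F : Λ → Type w) [∀ α, NonUnitalCStarAlgebra (F α)]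
      (D : ProjectiveLimit A F),
      (IsBaerStar A → (∀ α, Function.Surjective (D.π α)) →
        (∀ α, (NonUnitalStarSubalgebra.center ℂ A).map (D.π α) =
          NonUnitalStarSubalgebra.center ℂ (F α)) ∧
        (∀ α, IsAWStar (F α) → IsAWStarSubalgebra (NonUnitalStarSubalgebra.center ℂ (F α))) ∧
        D.RestrictsTo (NonUnitalStarSubalgebra.center ℂ A)
          (fun α => NonUnitalStarSubalgebra.center ℂ (F α))) ∧
      (∀ B : NonUnitalStarSubalgebra ℂ A, IsMaximalCommutative B →
        (∀ α, IsClosed (B.map (D.π α) : Set (F α))) ∧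
        D.RestrictsTo B (fun α => B.map (D.π α)) ∧
        (∀ α, IsAWStar (F α) → IsAWStarSubalgebra
          (NonUnitalStarSubalgebra.centralizer ℂ (B.map (D.π α) : Set (F α)))) ∧
        D.RestrictsTo B
          (fun α => NonUnitalStarSubalgebra.centralizer ℂ (B.map (D.π α) : Set (F α))) ∧
        ∀ C : ∀ α, NonUnitalStarSubalgebra ℂ (F α),
          (∀ α, IsMaximalCommutative (C α) ∧ B.map (D.π α) ≤ C α) →
          (∀ α, IsAWStar (F α) → IsAWStarSubalgebra (C α)) ∧
          ∀ x : A, x ∈ B ↔ ∀ α, D.π α x ∈ C α) ∧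
      ((∀ α, Function.Surjective (D.π α)) → ∀ (e : A) (he : IsStarProjection e),
        (∀ α, (starCorner e he).map (D.π α) = starCorner (D.π α e) (he.map (D.π α))) ∧
        (∀ α, IsAWStar (F α) →
          IsAWStarSubalgebra (starCorner (D.π α e) (he.map (D.π α)))) ∧
        D.RestrictsTo (starCorner e he)
          (fun α => starCorner (D.π α e) (he.map (D.π α)))) := by
  refine ⟨fun hA => ⟨hA.center, fun B hB => hA.isMaximalCommutative hB,
    fun e he => hA.starCorner he⟩, fun Λ _ F _ D => ⟨fun hA hπ => ?_, fun B hB => ?_,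
    fun hπ e he => ?_⟩⟩
  · exact ⟨fun α => D.map_center hA (hπ α), fun α hα => hα.center, D.restrictsTo_center hπ⟩
  · have hBD : D.IsFactorwiseClosed B := D.isFactorwiseClosed_of_isMaximalCommutative hB
    exact ⟨hBD.isClosed_map, hBD.restrictsTo_map, fun α hα => hα.centralizer _,
      D.restrictsTo_centralizer_map hB, fun C hC =>
      ⟨fun α hα => hα.isMaximalCommutative (hC α).1, fun x =>
        D.mem_iff_of_isMaximalCommutative hB (fun α => (hC α).1.prop) fun α => (hC α).2⟩⟩
  · exact ⟨fun α => D.map_starCorner he (hπ α), fun α hα => hα.starCorner _,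
      D.restrictsTo_starCorner he⟩

theorem theorem2 (A : Type u) [NonUnitalRing A] [StarRing A] [Module ℂ A]
    [IsScalarTower ℂ A A] [SMulCommClass ℂ A A] [StarModule ℂ A] [TopologicalSpace A]
    (hA : IsLocallyAWStar A) :
    -- the center, the maximal commutative subalgebras and the corners
    (IsLocallyAWStarSubalgebra (NonUnitalStarSubalgebra.center ℂ A) ∧
      (∀ B : NonUnitalStarSubalgebra ℂ A, IsMaximalCommutative B → IsLocallyAWStarSubalgebra B) ∧
      (∀ (e : A) (he : IsStarProjection e), IsLocallyAWStarSubalgebra (starCorner e he))) ∧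
    -- their realization as projective limits, for each Arens-Michael decomposition of `A`
    ∀ (Λ : Type v) [PartialOrder Λ] [IsDirectedOrder Λ] (F : Λ → Type w)
      [∀ α, NonUnitalCStarAlgebra (F α)] (D : ProjectiveLimit A F),
      (∀ α, Function.Surjective (D.π α)) →
      -- the center
      ((∀ α, (NonUnitalStarSubalgebra.center ℂ A).map (D.π α) =
            NonUnitalStarSubalgebra.center ℂ (F α)) ∧
        (∀ α, IsAWStar (F α) → IsAWStarSubalgebra (NonUnitalStarSubalgebra.center ℂ (F α))) ∧
        D.RestrictsTo (NonUnitalStarSubalgebra.center ℂ A)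
          (fun α => NonUnitalStarSubalgebra.center ℂ (F α))) ∧
      -- the maximal commutative subalgebras
      (∀ B : NonUnitalStarSubalgebra ℂ A, IsMaximalCommutative B →
        (∀ α, IsClosed (B.map (D.π α) : Set (F α))) ∧
        D.RestrictsTo B (fun α => B.map (D.π α)) ∧
        (∀ α, IsAWStar (F α) → IsAWStarSubalgebra
          (NonUnitalStarSubalgebra.centralizer ℂ (B.map (D.π α) : Set (F α)))) ∧
        D.RestrictsTo B
          (fun α => NonUnitalStarSubalgebra.centralizer ℂ (B.map (D.π α) : Set (F α))) ∧
        ∀ C : ∀ α, NonUnitalStarSubalgebra ℂ (F α),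
          (∀ α, IsMaximalCommutative (C α) ∧ B.map (D.π α) ≤ C α) →
          (∀ α, IsAWStar (F α) → IsAWStarSubalgebra (C α)) ∧
          ∀ x : A, x ∈ B ↔ ∀ α, D.π α x ∈ C α) ∧
      -- the corners
      (∀ (e : A) (he : IsStarProjection e),
        (∀ α, (starCorner e he).map (D.π α) = starCorner (D.π α e) (he.map (D.π α))) ∧
        (∀ α, IsAWStar (F α) →
          IsAWStarSubalgebra (starCorner (D.π α e) (he.map (D.π α)))) ∧
        D.RestrictsTo (starCorner e he)
          (fun α => starCorner (D.π α e) (he.map (D.π α)))) := by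
  have h := theorem2_general.{u, v, w} A
  exact ⟨h.1 hA, fun Λ _ _ F _ D hπ =>
    ⟨(h.2 Λ F D).1 hA.2 hπ, (h.2 Λ F D).2.1, (h.2 Λ F D).2.2 hπ⟩⟩
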